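/- Let $M$ be a $C^\infty$ manifold (finite-dimensional, Hausdorff, without boundary); all tensor fields are of class $C^\infty$. A bivector field $\Lambda$ on $M$ is identified with the skew-symmetric $C^\infty(M)$-linear map $\Lambda:\Omega^1(M)\to\mathfrak X(M)$ given by $\langle\beta,\Lambda\alpha\rangle=\Lambda(\alpha,\beta)$, and $[\cdot,\cdot]$ denotes the Schouten–Nijenhuis bracket. A Poisson tensor is a bivector field $\pi$ with $[\pi,\pi]=0$. A homogeneous Poisson manifold $(M,\pi,Z)$ is a manifold $M$ with a Poisson tensor $\pi$ and a vector field $Z$ such that $[Z,\pi]=-\pi$. For a bivector field $\Lambda$ put $\{\alpha,\beta\}_\Lambda=L_{\Lambda\alpha}\beta-L_{\Lambda\beta}\alpha-d(\Lambda(\alpha,\beta))$ for $\alpha,\beta\in\Omega^1(M)$, where $L_X=i_Xd+d\,i_X$ is the Lie derivative. A $(1,1)$-tensor field $J$ is a Nijenhuis tensor if $[JX,JY]-J[JX,Y]-J[X,JY]+J^2[X,Y]=0$ for all vector fields $X,Y$. A Nijenhuis tensor $J$ is compatible with a Poisson tensor $\pi$ if $J\circ\pi=\pi\circ{}^tJ$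 and, for all $\alpha,\beta\in\Omega^1(M)$, $$\{\alpha,\beta\}_{J\pi}-\big(\{{}^tJ\alpha,\beta\}_\pi+\{\alpha,{}^tJ\beta\}_\pi-{}^tJ\{\alpha,\beta\}_\pi\big)=0,$$ where $J\pi$ is the bivector field $J\circ\pi$. Theorem. Let $(M,\pi,Z)$ be a homogeneous Poisson manifold and let $J$ be a Nijenhuis tensor compatible with $\pi$. Then $(M,J\pi,Z)$ is a homogeneous Poisson manifold if and only if $$\pi\circ(L_Z\circ{}^tJ-{}^tJ\circ L_Z)=0\quad\text{on }\Omega^1(M).$$ When this holds, $J\pi-\lambda\pi$ is a Poisson pencil homogeneous with respect to $Z$: the tensors $J\pi$, $\pi$ and $J\pi-\lambda\pi$ for every $\lambda\in\mathbb R$ are Poisson tensors, and $[Z,J\pi-\lambda\pi]=-(J\pi-\lambda\pi)$ for every $\lambda\in\mathbb R$. -/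

import Mathlib

open scoped Manifold ContDiff

noncomputable section

namespace PoissonNijenhuis

open Bundle

/-! Tensor fields on a manifold `M` modelled on `E`, as families indexed by the points of `M`. Their
smoothness is expressed through Mathlib's tangent bundle and hom bundles. -/

section Fields

variable (E : Type*) [NormedAddCommGroup E] [NormedSpace ℝ E]
  (M : Type*) [TopologicalSpace M] [ChartedSpace E M]

/-- Vector fields on `M`. -/
abbrev VectorField := ∀ x : M, TangentSpace 𝓘(ℝ, E) x

/-- Differential 1-forms on `M`. -/
abbrev OneForm := ∀ x : M, TangentSpace 𝓘(ℝ, E) x →L[ℝ] ℝ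

/-- Fields of endomorphisms of the tangent spaces, i.e. (1,1)-tensor fields. -/
abbrev EndField := ∀ x : M, TangentSpace 𝓘(ℝ, E) x →L[ℝ] TangentSpace 𝓘(ℝ, E) x

/-- Fields of linear maps `T*_x M → T_x M`. A bivector field `Λ` is regarded as such a field, with
`⟨β, Λ α⟩ = Λ(α, β)`. -/
abbrev SharpField :=
  ∀ x : M, (TangentSpace 𝓘(ℝ, E) x →L[ℝ] ℝ) →L[ℝ] TangentSpace 𝓘(ℝ, E) x

end Fields

variable {E : Type*} [NormedAddCommGroup E] [NormedSpace ℝ E]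
  {M : Type*} [TopologicalSpace M] [ChartedSpace E M]

section Smooth

variable [IsManifold 𝓘(ℝ, E) ∞ M]

/-- The vector field `X` is of class `C^∞`. -/
def SmoothVectorField (X : VectorField E M) : Prop :=
  ContMDiff 𝓘(ℝ, E) (𝓘(ℝ, E).prod 𝓘(ℝ, E)) ∞
    (fun x : M => TotalSpace.mk' E (E := fun x : M => TangentSpace 𝓘(ℝ, E) x) x (X x))

/-- The 1-form `α` is of class `C^∞`. -/
def SmoothOneForm (α : OneForm E M) : Prop :=
  ContMDiff 𝓘(ℝ, E) (𝓘(ℝ, E).prod 𝓘(ℝ, E →L[ℝ] ℝ)) ∞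
    (fun x : M => TotalSpace.mk' (E →L[ℝ] ℝ)
      (E := fun x : M => TangentSpace 𝓘(ℝ, E) x →L[ℝ] ℝ) x (α x))

/-- The (1,1)-tensor field `J` is of class `C^∞`. -/
def SmoothEndField (J : EndField E M) : Prop :=
  ContMDiff 𝓘(ℝ, E) (𝓘(ℝ, E).prod 𝓘(ℝ, E →L[ℝ] E)) ∞
    (fun x : M => TotalSpace.mk' (E →L[ℝ] E)
      (E := fun x : M => TangentSpace 𝓘(ℝ, E) x →L[ℝ] TangentSpace 𝓘(ℝ, E) x) x (J x))

/-- The field `Λ` of maps `T*_x M → T_x M` is of class `C^∞`. -/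
def SmoothSharpField (Λ : SharpField E M) : Prop :=
  ContMDiff 𝓘(ℝ, E) (𝓘(ℝ, E).prod 𝓘(ℝ, (E →L[ℝ] ℝ) →L[ℝ] E)) ∞
    (fun x : M => TotalSpace.mk' ((E →L[ℝ] ℝ) →L[ℝ] E)
      (E := fun x : M =>
        (TangentSpace 𝓘(ℝ, E) x →L[ℝ] ℝ) →L[ℝ] TangentSpace 𝓘(ℝ, E) x) x (Λ x))

/-- `Λ` is a (smooth) bivector field: `⟨α, Λ β⟩ + ⟨β, Λ α⟩ = 0`. -/
def IsBivectorField (Λ : SharpField E M) : Prop :=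
  SmoothSharpField Λ ∧
    ∀ (x : M) (a b : TangentSpace 𝓘(ℝ, E) x →L[ℝ] ℝ), a (Λ x b) + b (Λ x a) = 0

end Smooth

section Operations

/-- The vector field `Λ α`. -/
def sharp (Λ : SharpField E M) (α : OneForm E M) : VectorField E M := fun x => Λ x (α x)

/-- The function `Λ(α, β) = ⟨β, Λ α⟩`. -/
def pairing (Λ : SharpField E M) (α β : OneForm E M) : M → ℝ := fun x => β x (Λ x (α x))

/-- The vector field `J X`. -/
def applyField (J : EndField E M) (X : VectorField E M) : VectorField E M := fun x => J x (X x)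

/-- The 1-form `ᵗJ α`. -/
def transposeForm (J : EndField E M) (α : OneForm E M) : OneForm E M :=
  fun x => (α x).comp (J x)

/-- The field `J ∘ Λ`. -/
def compField (J : EndField E M) (Λ : SharpField E M) : SharpField E M :=
  fun x => (J x).comp (Λ x)

/-- The differential `df` of a function. -/
def differential (f : M → ℝ) : OneForm E M := fun x => mfderiv 𝓘(ℝ, E) 𝓘(ℝ, ℝ) f x

/-- The function `X f = ⟨df, X⟩`. -/
def derivAlong (X : VectorField E M) (f : M → ℝ) : M → ℝ :=
  fun x => differential (E := E) f x (X x)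

/-- The expression of the 1-form `α` in the preferred chart at `x`. -/
def chartForm (α : OneForm E M) (x : M) : E → E →L[ℝ] ℝ := fun y =>
  (α ((extChartAt 𝓘(ℝ, E) x).symm y)).comp
    (mfderiv 𝓘(ℝ, E) 𝓘(ℝ, E) (extChartAt 𝓘(ℝ, E) x).symm y)

/-- The exterior derivative of a 1-form, `dα(u, v) = (D_u α)(v) - (D_v α)(u)` in the preferred chart
at `x`. For fixed `u` this is the covector `dα(u, ·)`. -/
def extDerivOneForm (α : OneForm E M) (x : M) (u : TangentSpace 𝓘(ℝ, E) x) :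
    TangentSpace 𝓘(ℝ, E) x →L[ℝ] ℝ :=
  let A : E →L[ℝ] E →L[ℝ] ℝ := fderiv ℝ (chartForm α x) (extChartAt 𝓘(ℝ, E) x x)
  let D : TangentSpace 𝓘(ℝ, E) x →L[ℝ] E :=
    mfderiv 𝓘(ℝ, E) 𝓘(ℝ, E) (extChartAt 𝓘(ℝ, E) x) x
  (A (D u) - A.flip (D u)).comp D

/-- The Lie derivative of a 1-form, `L_X α = i_X dα + d(i_X α)`. -/
def lieDerivOneForm (X : VectorField E M) (α : OneForm E M) : OneForm E M := fun x =>
  extDerivOneForm α x (X x) + differential (E := E) (fun y => α y (X y)) x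

/-- The bracket of 1-forms `{α, β}_Λ = L_{Λα} β - L_{Λβ} α - d(Λ(α, β))`. -/
def formBracket (Λ : SharpField E M) (α β : OneForm E M) : OneForm E M :=
  lieDerivOneForm (sharp Λ α) β - lieDerivOneForm (sharp Λ β) α - differential (pairing Λ α β)

/-- `C(Λ, J)(α, β) = {α, β}_{JΛ} - ({ᵗJα, β}_Λ + {α, ᵗJβ}_Λ - ᵗJ{α, β}_Λ)`. -/
def concomitant (Λ : SharpField E M) (J : EndField E M) (α β : OneForm E M) : OneForm E M :=
  formBracket (compField J Λ) α β -
    (formBracket Λ (transposeForm J α) β + formBracket Λ α (transposeForm J β) -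
      transposeForm J (formBracket Λ α β))

/-- The Nijenhuis torsion `N_J(X, Y) = [JX, JY] - J[JX, Y] - J[X, JY] + J²[X, Y]`. -/
def nijenhuisTorsion (J : EndField E M) (X Y : VectorField E M) : VectorField E M :=
  VectorField.mlieBracket 𝓘(ℝ, E) (applyField J X) (applyField J Y) -
    applyField J (VectorField.mlieBracket 𝓘(ℝ, E) (applyField J X) Y) -
    applyField J (VectorField.mlieBracket 𝓘(ℝ, E) X (applyField J Y)) +
    applyField J (applyField J (VectorField.mlieBracket 𝓘(ℝ, E) X Y))

/-- The Schouten-Nijenhuis bracket `[Z, Λ]` of a vector field and a bivector field, as a skew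
biderivation of the algebra of smooth functions, i.e. through its values `[Z, Λ](df, dg)`. -/
def schoutenVectorBivector (Z : VectorField E M) (Λ : SharpField E M) (f g : M → ℝ) : M → ℝ :=
  derivAlong Z (pairing Λ (differential f) (differential g)) -
    pairing Λ (differential (derivAlong Z f)) (differential g) -
    pairing Λ (differential f) (differential (derivAlong Z g))

/-- `Λ(d(Λ'(df, dg)), dh)`. -/
def nested (Λ Λ' : SharpField E M) (f g h : M → ℝ) : M → ℝ :=
  pairing Λ (differential (pairing Λ' (differential f) (differential g))) (differential h)

/-- The Schouten-Nijenhuis bracket `[Λ, Λ']` of two bivector fields, as a skew triderivation of the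
algebra of smooth functions, i.e. through its values `[Λ, Λ'](df, dg, dh)`. -/
def schoutenBivectorBivector (Λ Λ' : SharpField E M) (f g h : M → ℝ) : M → ℝ :=
  (nested Λ Λ' f g h + nested Λ Λ' g h f + nested Λ Λ' h f g) +
    (nested Λ' Λ f g h + nested Λ' Λ g h f + nested Λ' Λ h f g)

end Operations

section Structures

variable [IsManifold 𝓘(ℝ, E) ∞ M]

/-- `J` is a Nijenhuis tensor. -/
def IsNijenhuisTensor (J : EndField E M) : Prop :=
  SmoothEndField J ∧
    ∀ X Y : VectorField E M, SmoothVectorField X → SmoothVectorField Y →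
      nijenhuisTorsion J X Y = 0

/-- `P` is a Poisson tensor: a bivector field with `[P, P] = 0`. -/
def IsPoisson (P : SharpField E M) : Prop :=
  IsBivectorField P ∧
    ∀ f g h : M → ℝ, ContMDiff 𝓘(ℝ, E) 𝓘(ℝ, ℝ) ∞ f → ContMDiff 𝓘(ℝ, E) 𝓘(ℝ, ℝ) ∞ g →
      ContMDiff 𝓘(ℝ, E) 𝓘(ℝ, ℝ) ∞ h → schoutenBivectorBivector P P f g h = 0

/-- The bivector field `P` satisfies `[Z, P] = -P`. -/
def IsHomogeneous (P : SharpField E M) (Z : VectorField E M) : Prop :=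
  ∀ f g : M → ℝ, ContMDiff 𝓘(ℝ, E) 𝓘(ℝ, ℝ) ∞ f → ContMDiff 𝓘(ℝ, E) 𝓘(ℝ, ℝ) ∞ g →
    schoutenVectorBivector Z P f g = -pairing P (differential f) (differential g)

/-- `(M, P, Z)` is a homogeneous Poisson manifold. -/
def IsHomogeneousPoisson (P : SharpField E M) (Z : VectorField E M) : Prop :=
  IsPoisson P ∧ SmoothVectorField Z ∧ IsHomogeneous P Z

/-- `P` and `J` are compatible: `J ∘ P = P ∘ ᵗJ` and `C(P, J) = 0`. -/
def IsCompatible (P : SharpField E M) (J : EndField E M) : Prop :=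
  (∀ α : OneForm E M, SmoothOneForm α →
      sharp (compField J P) α = sharp P (transposeForm J α)) ∧
    ∀ α β : OneForm E M, SmoothOneForm α → SmoothOneForm β → concomitant P J α β = 0

/-- `P₁ - l P₂`, `l ∈ ℝ`, is a Poisson pencil. -/
def IsPoissonPencil (P₁ P₂ : SharpField E M) : Prop :=
  IsPoisson P₁ ∧ IsPoisson P₂ ∧ ∀ l : ℝ, IsPoisson (P₁ - l • P₂)

end Structures

end PoissonNijenhuis

end

/-! A bivector field `Λ` is skew, so its Lie derivative `L_X Λ`, with values
`(L_X Λ) α = [X, Λα] - Λ(L_X α)`, is determined by the exact forms. In these terms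
`[Z, P] = -P` says `L_Z P = -P`, and `[P, P] = 0` says that every Hamiltonian field
`X_f = P df` preserves `P`, i.e. `P(L_{X_f} α) = [X_f, Pα]`.

Let `J` be compatible with the Poisson tensor `P`. Evaluating the concomitant on `(dg, df)` and
applying `P` gives `P(L_{JX_f} dg) = [X_f, JX_g] - [X_g, JX_f] - J[X_f, X_g]`. Hence
`(L_{JX_f} JP) dg = N_J(X_f, X_g)`, so `JP` is Poisson exactly when the torsion of `J` vanishes
on Hamiltonian fields, and `L_{JX_f} P + L_{X_f} JP` vanishes on exact forms, which is
`[JP, P] = 0`. Finally `(L_Z JP) α = (L_Z P)(ᵗJα) + P(L_Z ᵗJα - ᵗJ L_Z α)`, and for homogeneous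
`P` the first term is `-JPα`. -/

noncomputable section

namespace PoissonNijenhuis

open Bundle VectorField

section HomBundle

variable {𝕜 B F₁ F₂ F₃ M : Type*} [NontriviallyNormedField 𝕜] {n : WithTop ℕ∞}
  {E₁ : B → Type*} [∀ x, AddCommGroup (E₁ x)] [∀ x, Module 𝕜 (E₁ x)]
  [NormedAddCommGroup F₁] [NormedSpace 𝕜 F₁]
  [TopologicalSpace (TotalSpace F₁ E₁)] [∀ x, TopologicalSpace (E₁ x)]
  {E₂ : B → Type*} [∀ x, AddCommGroup (E₂ x)] [∀ x, Module 𝕜 (E₂ x)]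
  [NormedAddCommGroup F₂] [NormedSpace 𝕜 F₂]
  [TopologicalSpace (TotalSpace F₂ E₂)] [∀ x, TopologicalSpace (E₂ x)]
  {E₃ : B → Type*} [∀ x, AddCommGroup (E₃ x)] [∀ x, Module 𝕜 (E₃ x)]
  [NormedAddCommGroup F₃] [NormedSpace 𝕜 F₃]
  [TopologicalSpace (TotalSpace F₃ E₃)] [∀ x, TopologicalSpace (E₃ x)]
  {EB : Type*} [NormedAddCommGroup EB] [NormedSpace 𝕜 EB] {HB : Type*} [TopologicalSpace HB]
  {IB : ModelWithCorners 𝕜 EB HB} [TopologicalSpace B] [ChartedSpace HB B]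
  {EM : Type*} [NormedAddCommGroup EM] [NormedSpace 𝕜 EM] {HM : Type*} [TopologicalSpace HM]
  {IM : ModelWithCorners 𝕜 EM HM} [TopologicalSpace M] [ChartedSpace HM M]
  [FiberBundle F₁ E₁] [VectorBundle 𝕜 F₁ E₁]
  [FiberBundle F₂ E₂] [VectorBundle 𝕜 F₂ E₂]
  [FiberBundle F₃ E₃] [VectorBundle 𝕜 F₃ E₃]
  [∀ x, IsTopologicalAddGroup (E₂ x)] [∀ x, ContinuousSMul 𝕜 (E₂ x)]
  [∀ x, IsTopologicalAddGroup (E₃ x)] [∀ x, ContinuousSMul 𝕜 (E₃ x)]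

theorem contMDiffAt_clm_bundle_comp {b : M → B} {x : M}
    {ψ : ∀ m, E₂ (b m) →L[𝕜] E₃ (b m)} {φ : ∀ m, E₁ (b m) →L[𝕜] E₂ (b m)}
    (hψ : CMDiffAt n (fun m ↦ TotalSpace.mk' (F₂ →L[𝕜] F₃)
      (E := fun x ↦ E₂ x →L[𝕜] E₃ x) (b m) (ψ m)) x)
    (hφ : CMDiffAt n (fun m ↦ TotalSpace.mk' (F₁ →L[𝕜] F₂)
      (E := fun x ↦ E₁ x →L[𝕜] E₂ x) (b m) (φ m)) x) :
    CMDiffAt n (fun m ↦ TotalSpace.mk' (F₁ →L[𝕜] F₃)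
      (E := fun x ↦ E₁ x →L[𝕜] E₃ x) (b m) ((ψ m).comp (φ m))) x := by
  rw [contMDiffAt_hom_bundle] at hψ hφ ⊢
  refine ⟨hψ.1, (hψ.2.clm_comp hφ.2).congr_of_eventuallyEq ?_⟩
  filter_upwards [hψ.1.continuousAt ((trivializationAt F₂ E₂ (b x)).open_baseSet.mem_nhds
    (FiberBundle.mem_baseSet_trivializationAt' (b x)))] with m hm
  ext v
  simp only [ContinuousLinearMap.inCoordinates, ContinuousLinearMap.comp_apply]
  rw [Trivialization.symmL_continuousLinearMapAt _ hm]

end HomBundle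

variable {E : Type*} [NormedAddCommGroup E] [NormedSpace ℝ E]
  {M : Type*} [TopologicalSpace M] [ChartedSpace E M]

section Smoothness

variable [IsManifold 𝓘(ℝ, E) ∞ M]

theorem smoothOneForm_iff_contMDiffAt_comp_symmL {α : OneForm E M} :
    SmoothOneForm α ↔ ∀ x₀ : M, ContMDiffAt 𝓘(ℝ, E) 𝓘(ℝ, E →L[ℝ] ℝ) ∞
      (fun x ↦ ((α x).comp
        ((trivializationAt E (TangentSpace 𝓘(ℝ, E)) x₀).symmL ℝ x) : E →L[ℝ] ℝ)) x₀ := by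
  refine forall_congr' fun x₀ ↦ (contMDiffAt_hom_bundle (E₂ := Trivial M ℝ) _).trans ?_
  have hcoord : (fun x ↦ ContinuousLinearMap.inCoordinates E (TangentSpace 𝓘(ℝ, E)) ℝ
      (Trivial M ℝ) x₀ x x₀ x (α x)) = fun x ↦ ((α x).comp
        ((trivializationAt E (TangentSpace 𝓘(ℝ, E)) x₀).symmL ℝ x) : E →L[ℝ] ℝ) := by
    funext x
    ext v
    simp [ContinuousLinearMap.inCoordinates]
  exact (and_iff_right contMDiffAt_id).trans (iff_of_eq (congrArg (CMDiffAt ∞ · x₀) hcoord))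

theorem SmoothOneForm.apply {α : OneForm E M} {X : VectorField E M} (hα : SmoothOneForm α)
    (hX : SmoothVectorField X) : CMDiff ∞ (fun x ↦ α x (X x)) := fun x ↦
  ((contMDiffAt_totalSpace ..).1
    (ContMDiffAt.clm_bundle_apply (E₂ := Trivial M ℝ) (hα x) (hX x))).2

theorem SmoothSharpField.sharp {Λ : SharpField E M} {α : OneForm E M} (hΛ : SmoothSharpField Λ)
    (hα : SmoothOneForm α) : SmoothVectorField (sharp Λ α) :=
  fun x ↦ ContMDiffAt.clm_bundle_apply (hΛ x) (hα x)

theorem SmoothSharpField.pairing {Λ : SharpField E M} {α β : OneForm E M}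
    (hΛ : SmoothSharpField Λ) (hα : SmoothOneForm α) (hβ : SmoothOneForm β) :
    CMDiff ∞ (pairing Λ α β) :=
  hβ.apply (hΛ.sharp hα)

theorem SmoothSharpField.sub_smul {Λ Λ' : SharpField E M} (hΛ : SmoothSharpField Λ)
    (hΛ' : SmoothSharpField Λ') (l : ℝ) : SmoothSharpField (Λ - l • Λ') :=
  ContMDiff.sub_section hΛ hΛ'.const_smul_section

theorem SmoothEndField.applyField {J : EndField E M} {X : VectorField E M} (hJ : SmoothEndField J)
    (hX : SmoothVectorField X) : SmoothVectorField (applyField J X) :=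
  fun x ↦ ContMDiffAt.clm_bundle_apply (hJ x) (hX x)

theorem SmoothEndField.transposeForm {J : EndField E M} {α : OneForm E M}
    (hJ : SmoothEndField J) (hα : SmoothOneForm α) : SmoothOneForm (transposeForm J α) :=
  fun x ↦ contMDiffAt_clm_bundle_comp (E₃ := Trivial M ℝ) (hα x) (hJ x)

theorem SmoothEndField.compField {J : EndField E M} {Λ : SharpField E M}
    (hJ : SmoothEndField J) (hΛ : SmoothSharpField Λ) : SmoothSharpField (compField J Λ) :=
  fun x ↦ contMDiffAt_clm_bundle_comp (hJ x) (hΛ x)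

theorem smoothOneForm_differential {f : M → ℝ} (hf : CMDiff ∞ f) :
    SmoothOneForm (differential (E := E) f) := by
  rw [smoothOneForm_iff_contMDiffAt_comp_symmL]
  refine fun x ↦
    ((hf x).mfderiv_const (m := ∞) le_rfl).congr_of_eventuallyEq (.of_forall fun y ↦ ?_)
  ext v
  simp only [differential, inTangentCoordinates, ContinuousLinearMap.inCoordinates,
    TangentBundle.continuousLinearMapAt_model_space, id_eq]
  rfl

end Smoothness

section Chart

/-- The expression of the vector field `X` in the preferred chart at `x`, matching `chartForm` for
1-forms. -/
def chartField (X : VectorField E M) (x : M) : E → E :=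
  mpullbackWithin 𝓘(ℝ, E) 𝓘(ℝ, E) (extChartAt 𝓘(ℝ, E) x).symm X (Set.range 𝓘(ℝ, E))

theorem differential_apply {f : M → ℝ} {x : M} (hf : MDifferentiableAt 𝓘(ℝ, E) 𝓘(ℝ, ℝ) f x)
    (v : TangentSpace 𝓘(ℝ, E) x) :
    differential (E := E) f x v =
      fderiv ℝ (f ∘ (extChartAt 𝓘(ℝ, E) x).symm) (extChartAt 𝓘(ℝ, E) x x) v := by
  simp only [differential, mfderiv, hf, modelWithCornersSelf_coe, Set.range_id, fderivWithin_univ]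
  rfl

variable [IsManifold 𝓘(ℝ, E) ∞ M]

theorem chartForm_chartField (α : OneForm E M) (X : VectorField E M) (x : M) {y : E}
    (hy : y ∈ (extChartAt 𝓘(ℝ, E) x).target) :
    chartForm α x y (chartField X x y) =
      α ((extChartAt 𝓘(ℝ, E) x).symm y) (X ((extChartAt 𝓘(ℝ, E) x).symm y)) := by
  have hinv := (isInvertible_mfderivWithin_extChartAt_symm (I := 𝓘(ℝ, E)) hy).self_apply_inverse
    (X ((extChartAt 𝓘(ℝ, E) x).symm y))
  rw [chartField, mpullbackWithin_apply, chartForm]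
  simp only [modelWithCornersSelf_coe, Set.range_id, mfderivWithin_univ] at hinv ⊢
  exact congrArg _ hinv

theorem chartForm_self (α : OneForm E M) (x : M) (v : E) :
    chartForm α x (extChartAt 𝓘(ℝ, E) x x) v = α x v := by
  have hid := mfderivWithin_range_extChartAt_symm (I := 𝓘(ℝ, E)) (x := x)
  simp only [modelWithCornersSelf_coe, Set.range_id, mfderivWithin_univ] at hid
  have hcongr : ∀ z, z = x → (α z : E →L[ℝ] ℝ) v = (α x : E →L[ℝ] ℝ) v := by rintro _ rfl; rfl
  rw [chartForm, hid]
  exact hcongr _ (extChartAt_to_inv x)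

theorem chartField_self (X : VectorField E M) (x : M) :
    chartField X x (extChartAt 𝓘(ℝ, E) x x) = X x := by
  have hcongr : ∀ z, z = x → (X z : E) = (X x : E) := by rintro _ rfl; rfl
  exact (mfderivWithin_extChartAt_symm_inverse_apply (I := 𝓘(ℝ, E)) (x := x) _).trans
    (hcongr _ (extChartAt_to_inv x))

theorem SmoothOneForm.contDiffAt_chartForm {α : OneForm E M} (hα : SmoothOneForm α) (x : M) :
    ContDiffAt ℝ ∞ (chartForm α x) (extChartAt 𝓘(ℝ, E) x x) := by
  have ht := extChartAt_target_mem_nhds (I := 𝓘(ℝ, E)) x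
  have hsymm := (contMDiffOn_extChartAt_symm (I := 𝓘(ℝ, E)) (n := ∞) x).contMDiffAt ht
  have hcoord := smoothOneForm_iff_contMDiffAt_comp_symmL.1 hα x
  refine (ContMDiffAt.comp_of_eq hcoord hsymm
    (extChartAt_to_inv x)).contDiffAt.congr_of_eventuallyEq ?_
  filter_upwards [ht] with y hy
  have hy' := (extChartAt 𝓘(ℝ, E) x).map_target hy
  rw [extChartAt_source] at hy'
  rw [Function.comp_apply, TangentBundle.symmL_trivializationAt hy',
    (extChartAt 𝓘(ℝ, E) x).right_inv hy]
  simp only [modelWithCornersSelf_coe, Set.range_id, mfderivWithin_univ]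
  rfl

theorem SmoothVectorField.differentiableAt_chartField [CompleteSpace E] {X : VectorField E M}
    (hX : SmoothVectorField X) (x : M) :
    DifferentiableAt ℝ (chartField X x) (extChartAt 𝓘(ℝ, E) x x) := by
  have hdiff := MDifferentiableWithinAt.differentiableWithinAt_mpullbackWithin_vectorField
    (I := 𝓘(ℝ, E)) (V := X) (s := Set.univ)
    ((hX x).mdifferentiableAt (by simp)).mdifferentiableWithinAt
  simp only [Set.preimage_univ, Set.univ_inter, modelWithCornersSelf_coe, Set.range_id] at hdiff
  simp only [chartField, modelWithCornersSelf_coe, Set.range_id]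
  exact differentiableWithinAt_univ.1 hdiff

theorem chartForm_differential {f : M → ℝ} (hf : CMDiff ∞ f) {x : M} {y : E}
    (hy : (extChartAt 𝓘(ℝ, E) x).target ∈ nhds y) :
    chartForm (differential f) x y = fderiv ℝ (f ∘ (extChartAt 𝓘(ℝ, E) x).symm) y := by
  have hsymm := ((contMDiffOn_extChartAt_symm (I := 𝓘(ℝ, E)) (n := ∞) x).contMDiffAt
    hy).mdifferentiableAt (by simp)
  rw [← mfderiv_eq_fderiv, mfderiv_comp _ ((hf _).mdifferentiableAt (by simp)) hsymm]
  rfl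

theorem differential_oneForm_apply [CompleteSpace E] {α : OneForm E M} {Y : VectorField E M}
    (hα : SmoothOneForm α) (hY : SmoothVectorField Y) (x : M) (v : TangentSpace 𝓘(ℝ, E) x) :
    differential (E := E) (fun y ↦ α y (Y y)) x v =
      fderiv ℝ (chartForm α x) (extChartAt 𝓘(ℝ, E) x x) v (Y x) +
        α x (fderiv ℝ (chartField Y x) (extChartAt 𝓘(ℝ, E) x x) v) := by
  have hchart : (fun y ↦ α y (Y y)) ∘ (extChartAt 𝓘(ℝ, E) x).symm
      =ᶠ[nhds (extChartAt 𝓘(ℝ, E) x x)] fun y ↦ chartForm α x y (chartField Y x y) := by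
    filter_upwards [extChartAt_target_mem_nhds (I := 𝓘(ℝ, E)) x] with y hy
    exact (chartForm_chartField α Y x hy).symm
  rw [differential_apply ((hα.apply hY x).mdifferentiableAt (by simp)), hchart.fderiv_eq,
    fderiv_clm_apply ((hα.contDiffAt_chartForm x).differentiableAt (by simp))
      (hY.differentiableAt_chartField x), ← chartForm_self α x, ← chartField_self Y x]
  exact add_comm _ _

theorem mlieBracket_eq_lieBracket_chartField (X Y : VectorField E M) (x : M) :
    mlieBracket 𝓘(ℝ, E) X Y x =
      lieBracket ℝ (chartField X x) (chartField Y x) (extChartAt 𝓘(ℝ, E) x x) := by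
  rw [mlieBracket, mlieBracketWithin_apply, mfderiv_extChartAt_self]
  simp only [Set.preimage_univ, Set.univ_inter, modelWithCornersSelf_coe, Set.range_id, chartField]
  refine (DFunLike.congr_fun (ContinuousLinearMap.inverse_id (R := ℝ) (M := E)) _).trans ?_
  exact congrFun lieBracketWithin_univ _

theorem extDerivOneForm_apply (α : OneForm E M) (x : M) (u v : TangentSpace 𝓘(ℝ, E) x) :
    extDerivOneForm α x u v =
      fderiv ℝ (chartForm α x) (extChartAt 𝓘(ℝ, E) x x) u v -
        fderiv ℝ (chartForm α x) (extChartAt 𝓘(ℝ, E) x x) v u := by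
  rw [extDerivOneForm, mfderiv_extChartAt_self]
  rfl

end Chart

section LieDerivative

variable [IsManifold 𝓘(ℝ, E) ∞ M]

theorem extDerivOneForm_apply_vectorField [CompleteSpace E] {α : OneForm E M}
    {X Y : VectorField E M} (hα : SmoothOneForm α) (hX : SmoothVectorField X)
    (hY : SmoothVectorField Y) (x : M) :
    extDerivOneForm α x (X x) (Y x) =
      derivAlong X (fun y ↦ α y (Y y)) x - derivAlong Y (fun y ↦ α y (X y)) x -
        α x (mlieBracket 𝓘(ℝ, E) X Y x) := by
  rw [extDerivOneForm_apply, mlieBracket_eq_lieBracket_chartField, lieBracket, derivAlong,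
    derivAlong, differential_oneForm_apply hα hX, differential_oneForm_apply hα hY,
    chartField_self, chartField_self]
  erw [map_sub]
  ring

theorem lieDerivOneForm_apply [CompleteSpace E] {α : OneForm E M} {X Y : VectorField E M}
    (hα : SmoothOneForm α) (hX : SmoothVectorField X) (hY : SmoothVectorField Y) (x : M) :
    lieDerivOneForm X α x (Y x) =
      derivAlong X (fun y ↦ α y (Y y)) x - α x (mlieBracket 𝓘(ℝ, E) X Y x) := by
  rw [lieDerivOneForm, add_apply, extDerivOneForm_apply_vectorField hα hX hY]
  simp only [derivAlong]
  ring

theorem extDerivOneForm_differential {f : M → ℝ} (hf : CMDiff ∞ f) (x : M)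
    (u : TangentSpace 𝓘(ℝ, E) x) : extDerivOneForm (differential (E := E) f) x u = 0 := by
  ext v
  have ht := extChartAt_target_mem_nhds (I := 𝓘(ℝ, E)) x
  have hsymm := (contMDiffOn_extChartAt_symm (I := 𝓘(ℝ, E)) (n := ∞) x).contMDiffAt ht
  have hchart : chartForm (differential (E := E) f) x =ᶠ[nhds (extChartAt 𝓘(ℝ, E) x x)]
      fderiv ℝ (f ∘ (extChartAt 𝓘(ℝ, E) x).symm) :=
    (eventually_eventually_nhds.2 ht).mono fun _ ↦ chartForm_differential hf
  rw [extDerivOneForm_apply, hchart.fderiv_eq]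
  refine sub_eq_zero.2 ((((hf _).comp _ hsymm).contDiffAt.isSymmSndFDerivAt ?_) u v)
  rw [minSmoothness_of_isRCLikeNormedField]
  exact WithTop.coe_le_coe.2 le_top

theorem lieDerivOneForm_differential {f : M → ℝ} (hf : CMDiff ∞ f) (X : VectorField E M) :
    lieDerivOneForm X (differential f) = differential (derivAlong X f) := by
  funext x
  rw [lieDerivOneForm, extDerivOneForm_differential hf, zero_add]
  rfl

end LieDerivative

section Separation

variable [IsManifold 𝓘(ℝ, E) ∞ M] [FiniteDimensional ℝ E] [T2Space M]

theorem exists_differential_eq (x : M) (a : E →L[ℝ] ℝ) :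
    ∃ f : M → ℝ, CMDiff ∞ f ∧ differential (E := E) f x = a := by
  obtain ⟨b⟩ : Nonempty (SmoothBumpFunction 𝓘(ℝ, E) x) := inferInstance
  let φ : M → E := extChartAt 𝓘(ℝ, E) x
  have hφ : ContMDiffOn 𝓘(ℝ, E) 𝓘(ℝ, ℝ) ∞ (a ∘ φ) (chartAt E x).source :=
    a.contMDiff.comp_contMDiffOn contMDiffOn_extChartAt
  refine ⟨fun y ↦ b y • a (φ y), b.contMDiff_smul hφ, ?_⟩
  have hgerm : (fun y ↦ b y • a (φ y)) =ᶠ[nhds x] a ∘ φ := by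
    filter_upwards [b.eventuallyEq_one] with y hy
    simp [hy]
  rw [differential, hgerm.mfderiv_eq, mfderiv_comp x a.mdifferentiableAt
    (mdifferentiableAt_extChartAt (mem_chart_source E x)), mfderiv_extChartAt_self,
    ContinuousLinearMap.mfderiv_eq]
  rfl

theorem vectorField_ext {X Y : VectorField E M}
    (h : ∀ f : M → ℝ, CMDiff ∞ f → derivAlong X f = derivAlong Y f) : X = Y := by
  funext x
  refine (SeparatingDual.eq_iff_forall_dual_eq (R := ℝ) (V := E)).2 fun a ↦ ?_
  obtain ⟨f, hf, rfl⟩ := exists_differential_eq (E := E) x a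
  exact congrFun (h f hf) x

end Separation

section LieDerivativeOfBivector

/-- The Hamiltonian vector field `Λ df` of the function `f`. -/
def hamiltonianField (Λ : SharpField E M) (f : M → ℝ) : VectorField E M :=
  sharp Λ (differential f)

/-- The Lie derivative `L_X Λ` of a bivector field, through its values
`(L_X Λ) α = [X, Λα] - Λ(L_X α)`. -/
def lieDerivSharp (X : VectorField E M) (Λ : SharpField E M) (α : OneForm E M) :
    VectorField E M :=
  mlieBracket 𝓘(ℝ, E) X (sharp Λ α) - sharp Λ (lieDerivOneForm X α)

theorem differential_neg (f : M → ℝ) : differential (E := E) (-f) = -differential f :=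
  funext fun _ ↦ mfderiv_neg

theorem derivAlong_neg (X : VectorField E M) (f : M → ℝ) :
    derivAlong X (-f) = -derivAlong X f := by
  funext x
  simp only [derivAlong, differential_neg]
  rfl

variable [IsManifold 𝓘(ℝ, E) ∞ M]

theorem SmoothSharpField.hamiltonianField {Λ : SharpField E M} {f : M → ℝ}
    (hΛ : SmoothSharpField Λ) (hf : CMDiff ∞ f) : SmoothVectorField (hamiltonianField Λ f) :=
  hΛ.sharp (smoothOneForm_differential hf)

theorem IsBivectorField.apply_swap {Λ : SharpField E M} (hΛ : IsBivectorField Λ) (x : M)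
    (a b : TangentSpace 𝓘(ℝ, E) x →L[ℝ] ℝ) : a (Λ x b) = -b (Λ x a) :=
  eq_neg_of_add_eq_zero_left (hΛ.2 x a b)

theorem IsBivectorField.pairing_swap {Λ : SharpField E M} (hΛ : IsBivectorField Λ)
    (α β : OneForm E M) : pairing Λ α β = -pairing Λ β α :=
  funext fun x ↦ hΛ.apply_swap x (β x) (α x)

section CompleteSpace

variable [CompleteSpace E]

theorem apply_lieDerivSharp {Λ : SharpField E M} {X : VectorField E M} {α β : OneForm E M}
    (hΛ : SmoothSharpField Λ) (hX : SmoothVectorField X) (hα : SmoothOneForm α)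
    (hβ : SmoothOneForm β) (x : M) :
    β x (lieDerivSharp X Λ α x) = derivAlong X (pairing Λ α β) x -
      pairing Λ (lieDerivOneForm X α) β x - pairing Λ α (lieDerivOneForm X β) x := by
  have hβX : pairing Λ α (lieDerivOneForm X β) x = derivAlong X (pairing Λ α β) x -
      β x (mlieBracket 𝓘(ℝ, E) X (sharp Λ α) x) := lieDerivOneForm_apply hβ hX (hΛ.sharp hα) x
  have hsub : β x (lieDerivSharp X Λ α x) = β x (mlieBracket 𝓘(ℝ, E) X (sharp Λ α) x) -
      pairing Λ (lieDerivOneForm X α) β x := map_sub (β x) _ _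
  linarith

theorem derivAlong_lieDerivSharp_differential {Λ : SharpField E M} {X : VectorField E M}
    {f g : M → ℝ} (hΛ : SmoothSharpField Λ) (hX : SmoothVectorField X) (hf : CMDiff ∞ f)
    (hg : CMDiff ∞ g) :
    derivAlong (lieDerivSharp X Λ (differential f)) g = schoutenVectorBivector X Λ f g := by
  funext x
  rw [derivAlong, apply_lieDerivSharp hΛ hX (smoothOneForm_differential hf)
    (smoothOneForm_differential hg), lieDerivOneForm_differential hf,
    lieDerivOneForm_differential hg]
  rfl

theorem IsBivectorField.apply_lieDerivSharp_swap {Λ : SharpField E M} {X : VectorField E M}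
    {α β : OneForm E M} (hΛ : IsBivectorField Λ) (hX : SmoothVectorField X)
    (hα : SmoothOneForm α) (hβ : SmoothOneForm β) (x : M) :
    β x (lieDerivSharp X Λ α x) = -α x (lieDerivSharp X Λ β x) := by
  rw [apply_lieDerivSharp hΛ.1 hX hα hβ, apply_lieDerivSharp hΛ.1 hX hβ hα,
    hΛ.pairing_swap α β, hΛ.pairing_swap _ β, hΛ.pairing_swap α, derivAlong_neg]
  simp only [Pi.neg_apply]
  ring

end CompleteSpace

variable [FiniteDimensional ℝ E] [T2Space M]

theorem lieDerivSharp_eq_smul_sharp_iff {Λ : SharpField E M} {X : VectorField E M}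
    (hΛ : IsBivectorField Λ) (hX : SmoothVectorField X) (c : ℝ) :
    (∀ α, SmoothOneForm α → lieDerivSharp X Λ α = c • sharp Λ α) ↔
      ∀ f g : M → ℝ, CMDiff ∞ f → CMDiff ∞ g →
        schoutenVectorBivector X Λ f g = c • pairing Λ (differential f) (differential g) := by
  have := FiniteDimensional.complete ℝ E
  have derivAlong_smul_sharp (α : OneForm E M) (g : M → ℝ) :
      derivAlong (c • sharp Λ α) g = c • pairing Λ α (differential g) :=
    funext fun x ↦ map_smul (differential g x) c _
  constructor
  · intro h f g hf hg
    rw [← derivAlong_lieDerivSharp_differential hΛ.1 hX hf hg,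
      h _ (smoothOneForm_differential hf), derivAlong_smul_sharp]
  · intro h α hα
    refine vectorField_ext fun f hf ↦ funext fun x ↦ ?_
    have hdf := smoothOneForm_differential (E := E) hf
    have hexact : lieDerivSharp X Λ (differential f) = c • sharp Λ (differential f) :=
      vectorField_ext fun g hg ↦ by
        rw [derivAlong_lieDerivSharp_differential hΛ.1 hX hf hg, h f g hf hg,
          derivAlong_smul_sharp]
    calc derivAlong (lieDerivSharp X Λ α) f x
        = -α x (c • sharp Λ (differential f) x) :=
          (hΛ.apply_lieDerivSharp_swap hX hα hdf x).trans (by rw [hexact]; rfl)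
      _ = c * -α x (sharp Λ (differential f) x) := by rw [map_smul, smul_eq_mul, mul_neg]
      _ = c * pairing Λ α (differential f) x :=
          congrArg (c * ·) (hΛ.apply_swap x _ _).symm
      _ = derivAlong (c • sharp Λ α) f x := (congrFun (derivAlong_smul_sharp α f) x).symm

theorem isHomogeneous_iff_lieDerivSharp {Λ : SharpField E M} {Z : VectorField E M}
    (hΛ : IsBivectorField Λ) (hZ : SmoothVectorField Z) :
    IsHomogeneous Λ Z ↔ ∀ α, SmoothOneForm α → lieDerivSharp Z Λ α = -sharp Λ α := by
  simpa only [IsHomogeneous, neg_smul, one_smul] using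
    (lieDerivSharp_eq_smul_sharp_iff hΛ hZ (-1)).symm

end LieDerivativeOfBivector

section Poisson

variable [IsManifold 𝓘(ℝ, E) ∞ M]

theorem IsBivectorField.schoutenVectorBivector_hamiltonianField {Λ Λ' : SharpField E M}
    (hΛ : IsBivectorField Λ) (hΛ' : IsBivectorField Λ') (f g h : M → ℝ) :
    schoutenVectorBivector (hamiltonianField Λ f) Λ' g h =
      -(nested Λ Λ' g h f + nested Λ' Λ f g h + nested Λ' Λ h f g) := by
  have hfirst : derivAlong (hamiltonianField Λ f) (pairing Λ' (differential g) (differential h)) =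
      -nested Λ Λ' g h f := hΛ.pairing_swap _ _
  have hthird : pairing Λ' (differential g) (differential (derivAlong (hamiltonianField Λ f) h)) =
      nested Λ' Λ h f g := by
    have hfh : derivAlong (hamiltonianField Λ f) h = -pairing Λ (differential h) (differential f) :=
      hΛ.pairing_swap _ _
    rw [hΛ'.pairing_swap, hfh, differential_neg]
    exact funext fun x ↦ by simp [nested, pairing]
  have hsecond : pairing Λ' (differential (derivAlong (hamiltonianField Λ f) g)) (differential h) =
      nested Λ' Λ f g h := rfl
  rw [schoutenVectorBivector, hfirst, hsecond, hthird]
  abel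

theorem IsBivectorField.schoutenBivectorBivector_eq {Λ Λ' : SharpField E M}
    (hΛ : IsBivectorField Λ) (hΛ' : IsBivectorField Λ') (f g h : M → ℝ) :
    schoutenBivectorBivector Λ Λ' f g h =
      -(schoutenVectorBivector (hamiltonianField Λ f) Λ' g h +
        schoutenVectorBivector (hamiltonianField Λ' f) Λ g h) := by
  rw [hΛ.schoutenVectorBivector_hamiltonianField hΛ',
    hΛ'.schoutenVectorBivector_hamiltonianField hΛ, schoutenBivectorBivector]
  abel

theorem IsBivectorField.isPoisson_iff_schoutenVectorBivector {Λ : SharpField E M}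
    (hΛ : IsBivectorField Λ) :
    IsPoisson Λ ↔ ∀ f : M → ℝ, CMDiff ∞ f → ∀ g h : M → ℝ, CMDiff ∞ g → CMDiff ∞ h →
      schoutenVectorBivector (hamiltonianField Λ f) Λ g h = 0 := by
  simp only [IsPoisson, hΛ, true_and, hΛ.schoutenBivectorBivector_eq hΛ, neg_eq_zero,
    ← two_smul ℝ (schoutenVectorBivector _ _ _ _), smul_eq_zero, two_ne_zero, false_or]
  exact ⟨fun hbracket f hf g h ↦ hbracket f g h hf, fun hbracket f g h hf ↦ hbracket f hf g h⟩

variable [FiniteDimensional ℝ E] [T2Space M]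

theorem IsBivectorField.isPoisson_iff_lieDerivSharp {Λ : SharpField E M}
    (hΛ : IsBivectorField Λ) :
    IsPoisson Λ ↔ ∀ f : M → ℝ, CMDiff ∞ f → ∀ α, SmoothOneForm α →
      lieDerivSharp (hamiltonianField Λ f) Λ α = 0 := by
  refine hΛ.isPoisson_iff_schoutenVectorBivector.trans (forall₂_congr fun f hf ↦ ?_)
  simpa only [zero_smul] using
    (lieDerivSharp_eq_smul_sharp_iff hΛ (hΛ.1.hamiltonianField hf) 0).symm

theorem IsPoisson.sharp_lieDerivOneForm_hamiltonianField {P : SharpField E M} (hP : IsPoisson P)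
    {f : M → ℝ} (hf : CMDiff ∞ f) {α : OneForm E M} (hα : SmoothOneForm α) :
    sharp P (lieDerivOneForm (hamiltonianField P f) α) =
      mlieBracket 𝓘(ℝ, E) (hamiltonianField P f) (sharp P α) :=
  (sub_eq_zero.1 (hP.1.isPoisson_iff_lieDerivSharp.1 hP f hf α hα)).symm

end Poisson

section Compatibility

theorem sharp_compField (J : EndField E M) (P : SharpField E M) (α : OneForm E M) :
    sharp (compField J P) α = applyField J (sharp P α) := rfl

theorem hamiltonianField_compField (J : EndField E M) (P : SharpField E M) (f : M → ℝ) :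
    hamiltonianField (compField J P) f = applyField J (hamiltonianField P f) := rfl

theorem applyField_sub (J : EndField E M) (X Y : VectorField E M) :
    applyField J (X - Y) = applyField J X - applyField J Y :=
  funext fun x ↦ map_sub (J x) _ _

theorem sharp_sub (Λ : SharpField E M) (α β : OneForm E M) :
    sharp Λ (α - β) = sharp Λ α - sharp Λ β :=
  funext fun x ↦ map_sub (Λ x) _ _

theorem lieDerivSharp_compField {P : SharpField E M} {J : EndField E M}
    (hcomm : ∀ (x : M) (a : TangentSpace 𝓘(ℝ, E) x →L[ℝ] ℝ), P x (a.comp (J x)) = J x (P x a))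
    (X : VectorField E M) (α : OneForm E M) :
    lieDerivSharp X (compField J P) α = lieDerivSharp X P (transposeForm J α) +
      sharp P (lieDerivOneForm X (transposeForm J α) - transposeForm J (lieDerivOneForm X α)) := by
  have hsharp (β : OneForm E M) : sharp (compField J P) β = sharp P (transposeForm J β) :=
    funext fun x ↦ (hcomm x (β x)).symm
  rw [lieDerivSharp, lieDerivSharp, hsharp, hsharp, sharp_sub]
  abel

variable [IsManifold 𝓘(ℝ, E) ∞ M]

theorem formBracket_differential_right (Λ : SharpField E M) (α : OneForm E M) {f : M → ℝ}
    (hf : CMDiff ∞ f) :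
    formBracket Λ α (differential f) = -lieDerivOneForm (hamiltonianField Λ f) α := by
  have hexact : lieDerivOneForm (sharp Λ α) (differential f) =
      differential (pairing Λ α (differential f)) := lieDerivOneForm_differential hf _
  rw [formBracket, hexact, hamiltonianField]
  abel

theorem IsBivectorField.formBracket_swap {Λ : SharpField E M} (hΛ : IsBivectorField Λ)
    (α β : OneForm E M) : formBracket Λ α β = -formBracket Λ β α := by
  rw [formBracket, formBracket, hΛ.pairing_swap, differential_neg]
  abel

theorem IsBivectorField.compField {P : SharpField E M} {J : EndField E M}
    (hP : IsBivectorField P) (hJ : SmoothEndField J)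
    (hcomm : ∀ (x : M) (a : TangentSpace 𝓘(ℝ, E) x →L[ℝ] ℝ), P x (a.comp (J x)) = J x (P x a)) :
    IsBivectorField (compField J P) := by
  refine ⟨hJ.compField hP.1, fun x a b ↦ ?_⟩
  have hskew := hP.2 x (a.comp (J x)) b
  rwa [hcomm x a] at hskew

theorem IsBivectorField.lieDerivOneForm_applyField_hamiltonianField {P : SharpField E M}
    {J : EndField E M} (hP : IsBivectorField P) {f g : M → ℝ} (hf : CMDiff ∞ f)
    (hg : CMDiff ∞ g) (hconc : concomitant P J (differential g) (differential f) = 0) :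
    lieDerivOneForm (applyField J (hamiltonianField P f)) (differential g) =
      lieDerivOneForm (hamiltonianField P f) (transposeForm J (differential g)) -
        lieDerivOneForm (hamiltonianField P g) (transposeForm J (differential f)) -
        transposeForm J (lieDerivOneForm (hamiltonianField P f) (differential g)) := by
  have hneg (α : OneForm E M) : transposeForm J (-α) = -transposeForm J α := rfl
  rw [concomitant, hP.formBracket_swap (differential g) (transposeForm J (differential f)),
    formBracket_differential_right _ _ hf, formBracket_differential_right _ _ hf,
    formBracket_differential_right _ _ hf, formBracket_differential_right _ _ hg,
    hamiltonianField_compField, hneg, sub_eq_zero] at hconc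
  rw [← neg_inj, hconc]
  abel

variable [FiniteDimensional ℝ E] [T2Space M]

theorem IsCompatible.sharp_comp_transpose {P : SharpField E M} {J : EndField E M}
    (hPJ : IsCompatible P J) (x : M) (a : TangentSpace 𝓘(ℝ, E) x →L[ℝ] ℝ) :
    P x (a.comp (J x)) = J x (P x a) := by
  obtain ⟨f, hf, rfl⟩ := exists_differential_eq (E := E) x a
  exact (congrFun (hPJ.1 _ (smoothOneForm_differential hf)) x).symm

theorem isHomogeneous_compField_iff {P : SharpField E M} {J : EndField E M} {Z : VectorField E M}
    (hP : IsBivectorField P) (hJ : SmoothEndField J) (hZ : SmoothVectorField Z)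
    (hcomm : ∀ (x : M) (a : TangentSpace 𝓘(ℝ, E) x →L[ℝ] ℝ), P x (a.comp (J x)) = J x (P x a))
    (hPZ : IsHomogeneous P Z) :
    IsHomogeneous (compField J P) Z ↔ ∀ α, SmoothOneForm α → sharp P
      (lieDerivOneForm Z (transposeForm J α) - transposeForm J (lieDerivOneForm Z α)) = 0 := by
  rw [isHomogeneous_iff_lieDerivSharp (hP.compField hJ hcomm) hZ]
  refine forall₂_congr fun α hα ↦ ?_
  have hsharp : sharp P (transposeForm J α) = sharp (compField J P) α :=
    funext fun x ↦ hcomm x (α x)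
  rw [lieDerivSharp_compField hcomm,
    (isHomogeneous_iff_lieDerivSharp hP hZ).1 hPZ _ (hJ.transposeForm hα), hsharp, add_eq_left]

theorem IsPoisson.sharp_lieDerivOneForm_applyField_hamiltonianField {P : SharpField E M}
    {J : EndField E M} (hP : IsPoisson P) (hJ : SmoothEndField J) (hPJ : IsCompatible P J)
    {f g : M → ℝ} (hf : CMDiff ∞ f) (hg : CMDiff ∞ g) :
    sharp P (lieDerivOneForm (applyField J (hamiltonianField P f)) (differential g)) =
      mlieBracket 𝓘(ℝ, E) (hamiltonianField P f) (applyField J (hamiltonianField P g)) -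
        mlieBracket 𝓘(ℝ, E) (hamiltonianField P g) (applyField J (hamiltonianField P f)) -
        applyField J (mlieBracket 𝓘(ℝ, E) (hamiltonianField P f) (hamiltonianField P g)) := by
  have hdf := smoothOneForm_differential (E := E) hf
  have hdg := smoothOneForm_differential (E := E) hg
  have hsharp (α : OneForm E M) : sharp P (transposeForm J α) = applyField J (sharp P α) :=
    funext fun x ↦ hPJ.sharp_comp_transpose x (α x)
  rw [hP.1.lieDerivOneForm_applyField_hamiltonianField hf hg (hPJ.2 _ _ hdg hdf), sharp_sub,
    sharp_sub, hsharp,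
    hP.sharp_lieDerivOneForm_hamiltonianField hf (hJ.transposeForm hdg),
    hP.sharp_lieDerivOneForm_hamiltonianField hg (hJ.transposeForm hdf),
    hP.sharp_lieDerivOneForm_hamiltonianField hf hdg, hsharp, hsharp]
  rfl

theorem IsPoisson.lieDerivSharp_applyField_hamiltonianField {P : SharpField E M}
    {J : EndField E M} (hP : IsPoisson P) (hJ : SmoothEndField J) (hPJ : IsCompatible P J)
    {f g : M → ℝ} (hf : CMDiff ∞ f) (hg : CMDiff ∞ g) :
    lieDerivSharp (applyField J (hamiltonianField P f)) P (differential g) =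
      -lieDerivSharp (hamiltonianField P f) (compField J P) (differential g) := by
  have hPfg := hP.sharp_lieDerivOneForm_hamiltonianField hf (smoothOneForm_differential hg)
  rw [lieDerivSharp, lieDerivSharp, sharp_compField, sharp_compField, hPfg,
    hP.sharp_lieDerivOneForm_applyField_hamiltonianField hJ hPJ hf hg,
    mlieBracket_swap (V := hamiltonianField P g)]
  simp only [hamiltonianField]
  abel

theorem IsPoisson.lieDerivSharp_compField_hamiltonianField {P : SharpField E M}
    {J : EndField E M} (hP : IsPoisson P) (hJ : SmoothEndField J) (hPJ : IsCompatible P J)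
    {f g : M → ℝ} (hf : CMDiff ∞ f) (hg : CMDiff ∞ g) :
    lieDerivSharp (applyField J (hamiltonianField P f)) (compField J P) (differential g) =
      nijenhuisTorsion J (hamiltonianField P f) (hamiltonianField P g) := by
  rw [lieDerivSharp, sharp_compField, sharp_compField,
    hP.sharp_lieDerivOneForm_applyField_hamiltonianField hJ hPJ hf hg,
    mlieBracket_swap (V := hamiltonianField P g), applyField_sub, applyField_sub, nijenhuisTorsion]
  have hneg (X : VectorField E M) : applyField J (-X) = -applyField J X :=
    funext fun x ↦ map_neg (J x) _
  rw [hneg]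
  simp only [hamiltonianField]
  abel

theorem IsPoisson.schoutenBivectorBivector_compField {P : SharpField E M}
    {J : EndField E M} (hP : IsPoisson P) (hJ : SmoothEndField J) (hPJ : IsCompatible P J)
    {f g h : M → ℝ} (hf : CMDiff ∞ f) (hg : CMDiff ∞ g) (hh : CMDiff ∞ h) :
    schoutenBivectorBivector (compField J P) P f g h = 0 := by
  have := FiniteDimensional.complete ℝ E
  have hQ := hP.1.compField hJ hPJ.sharp_comp_transpose
  have hX := hP.1.1.hamiltonianField hf
  rw [hQ.schoutenBivectorBivector_eq hP.1, hamiltonianField_compField,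
    ← derivAlong_lieDerivSharp_differential hP.1.1 (hJ.applyField hX) hg hh,
    ← derivAlong_lieDerivSharp_differential hQ.1 hX hg hh,
    hP.lieDerivSharp_applyField_hamiltonianField hJ hPJ hf hg]
  funext x
  simp [derivAlong]

theorem IsPoisson.isPoisson_compField_iff {P : SharpField E M}
    {J : EndField E M} (hP : IsPoisson P) (hJ : SmoothEndField J) (hPJ : IsCompatible P J) :
    IsPoisson (compField J P) ↔ ∀ f g : M → ℝ, CMDiff ∞ f → CMDiff ∞ g →
      nijenhuisTorsion J (hamiltonianField P f) (hamiltonianField P g) = 0 := by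
  have := FiniteDimensional.complete ℝ E
  have hQ := hP.1.compField hJ hPJ.sharp_comp_transpose
  constructor
  · intro hPoisson f g hf hg
    rw [← hP.lieDerivSharp_compField_hamiltonianField hJ hPJ hf hg]
    exact hQ.isPoisson_iff_lieDerivSharp.1 hPoisson f hf _ (smoothOneForm_differential hg)
  · intro htorsion
    refine hQ.isPoisson_iff_schoutenVectorBivector.2 fun f hf g h hg hh ↦ ?_
    have hX := hJ.applyField (hP.1.1.hamiltonianField hf)
    rw [hamiltonianField_compField, ← derivAlong_lieDerivSharp_differential hQ.1 hX hg hh,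
      hP.lieDerivSharp_compField_hamiltonianField hJ hPJ hf hg, htorsion f g hf hg]
    exact funext fun x ↦ map_zero (differential h x)

end Compatibility

section Pencil

theorem pairing_sub_smul (Λ Λ' : SharpField E M) (l : ℝ) (α β : OneForm E M) :
    pairing (Λ - l • Λ') α β = pairing Λ α β - l • pairing Λ' α β := by
  funext x
  simp [pairing]

theorem nested_sub_smul_left (Λ Λ' Λ'' : SharpField E M) (l : ℝ) (f g h : M → ℝ) :
    nested (Λ - l • Λ') Λ'' f g h = nested Λ Λ'' f g h - l • nested Λ' Λ'' f g h :=
  pairing_sub_smul ..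

theorem schoutenBivectorBivector_comm (Λ Λ' : SharpField E M) (f g h : M → ℝ) :
    schoutenBivectorBivector Λ Λ' f g h = schoutenBivectorBivector Λ' Λ f g h :=
  add_comm _ _

theorem differential_sub_smul {f g : M → ℝ} (hf : MDifferentiable 𝓘(ℝ, E) 𝓘(ℝ, ℝ) f)
    (hg : MDifferentiable 𝓘(ℝ, E) 𝓘(ℝ, ℝ) g) (l : ℝ) :
    differential (E := E) (f - l • g) = differential f - l • differential g :=
  funext fun x ↦ ((hf x).hasMFDerivAt.sub ((hg x).hasMFDerivAt.const_smul l)).mfderiv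

variable [IsManifold 𝓘(ℝ, E) ∞ M]

theorem differential_pairing_sub_smul {Λ Λ' : SharpField E M} {α β : OneForm E M}
    (hΛ : SmoothSharpField Λ) (hΛ' : SmoothSharpField Λ') (l : ℝ) (hα : SmoothOneForm α)
    (hβ : SmoothOneForm β) :
    differential (E := E) (pairing (Λ - l • Λ') α β) =
      differential (pairing Λ α β) - l • differential (pairing Λ' α β) := by
  rw [pairing_sub_smul, differential_sub_smul ((hΛ.pairing hα hβ).mdifferentiable (by simp))
    ((hΛ'.pairing hα hβ).mdifferentiable (by simp))]

theorem nested_sub_smul_right (Λ : SharpField E M) {Λ' Λ'' : SharpField E M}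
    (hΛ' : SmoothSharpField Λ') (hΛ'' : SmoothSharpField Λ'') (l : ℝ) {f g : M → ℝ}
    (hf : CMDiff ∞ f) (hg : CMDiff ∞ g) (h : M → ℝ) :
    nested Λ (Λ' - l • Λ'') f g h = nested Λ Λ' f g h - l • nested Λ Λ'' f g h := by
  rw [nested, differential_pairing_sub_smul hΛ' hΛ'' l (smoothOneForm_differential hf)
    (smoothOneForm_differential hg)]
  funext x
  simp [nested, pairing]

theorem schoutenBivectorBivector_sub_smul_left {Λ Λ' : SharpField E M} (hΛ : SmoothSharpField Λ)
    (hΛ' : SmoothSharpField Λ') (Λ'' : SharpField E M) (l : ℝ) {f g h : M → ℝ}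
    (hf : CMDiff ∞ f) (hg : CMDiff ∞ g) (hh : CMDiff ∞ h) :
    schoutenBivectorBivector (Λ - l • Λ') Λ'' f g h =
      schoutenBivectorBivector Λ Λ'' f g h - l • schoutenBivectorBivector Λ' Λ'' f g h := by
  simp only [schoutenBivectorBivector, nested_sub_smul_left,
    nested_sub_smul_right Λ'' hΛ hΛ' l hf hg, nested_sub_smul_right Λ'' hΛ hΛ' l hg hh,
    nested_sub_smul_right Λ'' hΛ hΛ' l hh hf]
  module

theorem schoutenVectorBivector_sub_smul {Λ Λ' : SharpField E M} (hΛ : SmoothSharpField Λ)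
    (hΛ' : SmoothSharpField Λ') (Z : VectorField E M) (l : ℝ) {f g : M → ℝ} (hf : CMDiff ∞ f)
    (hg : CMDiff ∞ g) :
    schoutenVectorBivector Z (Λ - l • Λ') f g =
      schoutenVectorBivector Z Λ f g - l • schoutenVectorBivector Z Λ' f g := by
  have hderiv : derivAlong Z (pairing (Λ - l • Λ') (differential f) (differential g)) =
      derivAlong Z (pairing Λ (differential f) (differential g)) -
        l • derivAlong Z (pairing Λ' (differential f) (differential g)) := by
    funext x
    simp [derivAlong, differential_pairing_sub_smul hΛ hΛ' l (smoothOneForm_differential hf)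
      (smoothOneForm_differential hg)]
  rw [schoutenVectorBivector, hderiv, pairing_sub_smul, pairing_sub_smul]
  simp only [schoutenVectorBivector]
  module

theorem IsBivectorField.sub_smul {Λ Λ' : SharpField E M} (hΛ : IsBivectorField Λ)
    (hΛ' : IsBivectorField Λ') (l : ℝ) : IsBivectorField (Λ - l • Λ') := by
  refine ⟨hΛ.1.sub_smul hΛ'.1 l, fun x a b ↦ ?_⟩
  change a (Λ x b - l • Λ' x b) + b (Λ x a - l • Λ' x a) = 0
  simp only [map_sub, map_smul, smul_eq_mul]
  linear_combination hΛ.2 x a b - l * hΛ'.2 x a b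

theorem IsPoisson.sub_smul {P P' : SharpField E M} (hP : IsPoisson P) (hP' : IsPoisson P')
    (hPP' : ∀ f g h : M → ℝ, CMDiff ∞ f → CMDiff ∞ g → CMDiff ∞ h →
      schoutenBivectorBivector P P' f g h = 0) (l : ℝ) : IsPoisson (P - l • P') := by
  refine ⟨hP.1.sub_smul hP'.1 l, fun f g h hf hg hh ↦ ?_⟩
  have hleft (Λ : SharpField E M) :=
    schoutenBivectorBivector_sub_smul_left hP.1.1 hP'.1.1 Λ l hf hg hh
  rw [hleft, schoutenBivectorBivector_comm P, schoutenBivectorBivector_comm P', hleft, hleft,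
    schoutenBivectorBivector_comm P' P, hP.2 f g h hf hg hh, hP'.2 f g h hf hg hh,
    hPP' f g h hf hg hh]
  simp

theorem IsHomogeneous.sub_smul {Λ Λ' : SharpField E M} {Z : VectorField E M}
    (hΛ : SmoothSharpField Λ) (hΛ' : SmoothSharpField Λ') (hΛZ : IsHomogeneous Λ Z)
    (hΛ'Z : IsHomogeneous Λ' Z) (l : ℝ) : IsHomogeneous (Λ - l • Λ') Z := by
  intro f g hf hg
  rw [schoutenVectorBivector_sub_smul hΛ hΛ' Z l hf hg, hΛZ f g hf hg, hΛ'Z f g hf hg,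
    pairing_sub_smul]
  module

end Pencil

theorem mainTheorem3_general [IsManifold 𝓘(ℝ, E) ∞ M] [FiniteDimensional ℝ E] [T2Space M]
    {P : SharpField E M} {Z : VectorField E M} {J : EndField E M}
    (hP : IsHomogeneousPoisson P Z) (hJ : SmoothEndField J) (hPJ : IsCompatible P J)
    (htorsion : ∀ f g : M → ℝ, CMDiff ∞ f → CMDiff ∞ g →
      nijenhuisTorsion J (hamiltonianField P f) (hamiltonianField P g) = 0) :
    (IsHomogeneousPoisson (compField J P) Z ↔
      ∀ α : OneForm E M, SmoothOneForm α → sharp P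
        (lieDerivOneForm Z (transposeForm J α) - transposeForm J (lieDerivOneForm Z α)) = 0) ∧
    IsPoissonPencil (compField J P) P ∧
    (IsHomogeneous (compField J P) Z → ∀ l : ℝ, IsHomogeneous (compField J P - l • P) Z) := by
  obtain ⟨hPoisson, hZ, hPZ⟩ := hP
  have hQ : IsPoisson (compField J P) := (hPoisson.isPoisson_compField_iff hJ hPJ).2 htorsion
  have hQP (f g h : M → ℝ) (hf : CMDiff ∞ f) (hg : CMDiff ∞ g) (hh : CMDiff ∞ h) :
      schoutenBivectorBivector (compField J P) P f g h = 0 :=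
    hPoisson.schoutenBivectorBivector_compField hJ hPJ hf hg hh
  have hQZ := isHomogeneous_compField_iff hPoisson.1 hJ hZ hPJ.sharp_comp_transpose hPZ
  refine ⟨?_, ⟨hQ, hPoisson, hQ.sub_smul hPoisson hQP⟩,
    fun h ↦ IsHomogeneous.sub_smul hQ.1.1 hPoisson.1.1 h hPZ⟩
  rw [← hQZ]
  exact ⟨fun h ↦ h.2.2, fun h ↦ ⟨hQ, hZ, h⟩⟩

end PoissonNijenhuis

end

theorem mainTheorem3
    {E : Type*} [NormedAddCommGroup E] [NormedSpace ℝ E] [FiniteDimensional ℝ E]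
    {M : Type*} [TopologicalSpace M] [T2Space M] [ChartedSpace E M] [IsManifold 𝓘(ℝ, E) ∞ M]
    (P : PoissonNijenhuis.SharpField E M) (Z : PoissonNijenhuis.VectorField E M)
    (J : PoissonNijenhuis.EndField E M)
    (hP : PoissonNijenhuis.IsHomogeneousPoisson P Z)
    (hJ : PoissonNijenhuis.IsNijenhuisTensor J)
    (hPJ : PoissonNijenhuis.IsCompatible P J) :
    (PoissonNijenhuis.IsHomogeneousPoisson (PoissonNijenhuis.compField J P) Z ↔
      ∀ α : PoissonNijenhuis.OneForm E M, PoissonNijenhuis.SmoothOneForm α →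
        PoissonNijenhuis.sharp P
          (PoissonNijenhuis.lieDerivOneForm Z (PoissonNijenhuis.transposeForm J α) -
            PoissonNijenhuis.transposeForm J (PoissonNijenhuis.lieDerivOneForm Z α)) = 0) ∧
    ((∀ α : PoissonNijenhuis.OneForm E M, PoissonNijenhuis.SmoothOneForm α →
        PoissonNijenhuis.sharp P
          (PoissonNijenhuis.lieDerivOneForm Z (PoissonNijenhuis.transposeForm J α) -
            PoissonNijenhuis.transposeForm J (PoissonNijenhuis.lieDerivOneForm Z α)) = 0) →
      PoissonNijenhuis.IsPoissonPencil (PoissonNijenhuis.compField J P) P ∧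
      ∀ l : ℝ, PoissonNijenhuis.IsHomogeneous (PoissonNijenhuis.compField J P - l • P) Z) := by
  obtain ⟨hiff, hpencil, hhom⟩ := PoissonNijenhuis.mainTheorem3_general hP hJ.1 hPJ fun _ _ hf hg ↦
    hJ.2 _ _ (hP.1.1.1.hamiltonianField hf) (hP.1.1.1.hamiltonianField hg)
  exact ⟨hiff, fun hcond ↦ ⟨hpencil, hhom (hiff.2 hcond).2.2⟩⟩
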